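/- Fix a first-order language $L$ with equality and infinitely many variables. Expressions are terms of $L$, Boolean expressions are quantifier-free formulas of $L$, and assertions are formulas of $L$. Statements are given by $$S ::= skip \mid \bar x:=\bar t \mid P(\bar t)\mid S;S\mid \mathbf{if}\ B\ \mathbf{then}\ S\ \mathbf{else}\ S\ \mathbf{fi}\mid \mathbf{while}\ B\ \mathbf{do}\ S\ \mathbf{od}\mid \mathbf{begin\ local}\ \bar x:=\bar t;\,S\ \mathbf{end},$$ where each $\bar x$ is a list of distinct variables. A program $(D\mid S)$ consists of a statement $S$ and a finite set $D=\{P_i(\bar u_i)::S_i\mid 1\le i\le n\}$ of (mutually recursive) procedure declarations, with distinct formal parameters $\bar u_i$, in which each procedure used in $S$ or in a body $S_i$ is declared exactly once, calls having the right number of arguments. For an interpretation $I$ of $L$ (with non-empty domain) the meaning of $(D\mid S)$ is the usual partial function on states. A block $\mathbf{begin\ local}\ \bar x:=\bar t;S\ \mathbf{end}$ executes $\bar x:=\bar t;S$ and then restores the initial values of $\bar x$, and the call $P_i(\bar t)$ means $\mathbf{begin\ local}\ \bar u_i:=\bar t;S_i\ \mathbf{end}$ (call-by-value, dynamic scope).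 A correctness formula $\{p\}S\{q\}$ is true in $I$, written $I\models\{p\}S\{q\}$, if every state reached by $(D\mid S)$ from a state satisfying $p$ satisfies $q$. $L$ is expressive relative to $I$ if for every assertion $p$ and program $(D\mid S)$ the set of states reachable by $(D\mid S)$ from states satisfying $p$ is defined by a formula of $L$. Let $var(D\mid S)$ be the set of variables occurring in $(D\mid S)$. Let $change(D\mid S)$ consist of the variables assigned in $S$, where local variables are removed at each block and a call of $P_i$ contributes $change(D)\setminus\{\bar u_i\}$; here $change(D)$ is the union over all $i$ of the same set for $S_i$ with calls contributing $\emptyset$. The proof system $CBV$ has the usual axioms for $skip$ and parallel assignment ($\{p[\bar x:=\bar t]\}\,\bar x:=\bar t\,\{p\}$), the usual rules for composition, conditional and while, the consequence rule, and the following rules. * BLOCK: from $\{p\}\bar x:=\bar t;S\{q\}$ infer $\{p\}\mathbf{begin\ local}\ \bar x:=\bar t;S\ \mathbf{end}\{q\}$, if $\{\bar x\}\cap free(q)=\emptyset$. * PROCEDURE CALL: from $\{p\}P_i(\bar u_i)\{q\}$ infer $\{p[\bar u_i:=\bar t]\}P_i(\bar t)\{q\}$, if $\{\bar u_i\}\cap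 free(q)=\emptyset$. * SUBSTITUTION: from $\{p\}S\{q\}$ infer $\{p[\bar x:=\bar y]\}S\{q[\bar x:=\bar y]\}$ ($\bar y$ a list of variables), if $\{\bar x\}\cap var(D\mid S)=\emptyset$ and $\{\bar y\}\cap change(D\mid S)=\emptyset$. * INVARIANCE: from $\{r\}S\{q\}$ infer $\{p\wedge r\}S\{p\wedge q\}$, if $free(p)\cap change(D\mid S)=\emptyset$. * $\exists$-INTRODUCTION: from $\{p\}S\{q\}$ infer $\{\exists\bar x:p\}S\{q\}$, if $\{\bar x\}\cap(var(D\mid S)\cup free(q))=\emptyset$. * RECURSION: infer $\{p\}S\{q\}$ if, from the assumptions $\{p_i\}P_i(\bar u_i)\{q_i\}$ $(1\le i\le n)$ with $\{\bar u_i\}\cap free(q_i)=\emptyset$, the formula $\{p\}S\{q\}$ and all the formulas $\{p_i\}S_i\{q_i\}$ $(1\le i\le n)$ are provable by the other axioms and rules. Write $\vdash^k_I\{p\}S\{q\}$ if $\{p\}S\{q\}$ has a proof in $CBV$, in which all assertions true in $I$ may be used as premises of the consequence rule, that consists of at most $k$ applications of axioms and proof rules (those in subsidiary proofs included). Define $l(skip)=l(\bar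 x:=\bar t)=l(P(\bar t))=1$, $l(S_1;S_2)=l(\mathbf{if}\ B\ \mathbf{then}\ S_1\ \mathbf{else}\ S_2\ \mathbf{fi})=l(S_1)+l(S_2)+1$, $l(\mathbf{while}\ B\ \mathbf{do}\ S\ \mathbf{od})=l(S)+1$, $l(\mathbf{begin\ local}\ \bar x:=\bar t;S\ \mathbf{end})=l(\bar x:=\bar t;S)+1$, and $l(D\mid S)=l(S)+\sum_{i=1}^n l(S_i)$. **Theorem.** There is an absolute constant $C$ such that the following holds. Let $I$ be an interpretation such that $L$ is expressive relative to $I$, let $(D\mid T)$ be a program, and let $p,q$ be assertions. If $I\models\{p\}T\{q\}$, then $\vdash_I^{\,C\cdot l(D\mid T)}\{p\}T\{q\}$. That is, $\vdash_I^{O(l(D\mid T))}\{p\}T\{q\}$. -/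

import Mathlib

universe u v w z

namespace CBV

open FirstOrder.Language

/- A list of `m` distinct variables is an injection `x : Fin m ↪ Var`; a list of `m` expressions is a
function `Fin m → L.Term Var`.  States are functions `Var → M`.  For a state `σ`, the simultaneous
update `σ[x := d]` is `Function.extend x d σ`. -/

/-- Assertions: first-order formulas of `L` (with equality) whose free variables are in `Var`. -/
abbrev Assertion (L : FirstOrder.Language.{u, v}) (Var : Type w) : Type (max u v w) := L.Formula Var

/-- Boolean expressions: quantifier-free formulas. -/
abbrev BoolExpr (L : FirstOrder.Language.{u, v}) (Var : Type w) : Type (max u v w) :=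
  {B : L.Formula Var // B.IsQF}

/-- Statements over `n` procedures, the `i`-th of which has `ar i` parameters. -/
inductive Stmt (L : FirstOrder.Language.{u, v}) (Var : Type w) {n : ℕ} (ar : Fin n → ℕ) :
    Type (max u v w) where
  | skip : Stmt L Var ar
  | assign {m : ℕ} (x : Fin m ↪ Var) (t : Fin m → L.Term Var) : Stmt L Var ar
  | call (i : Fin n) (t : Fin (ar i) → L.Term Var) : Stmt L Var ar
  | seq (S₁ S₂ : Stmt L Var ar) : Stmt L Var ar
  | ite (B : BoolExpr L Var) (S₁ S₂ : Stmt L Var ar) : Stmt L Var ar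
  | while (B : BoolExpr L Var) (S : Stmt L Var ar) : Stmt L Var ar
  /-- `begin local x := t; S end` -/
  | block {m : ℕ} (x : Fin m ↪ Var) (t : Fin m → L.Term Var) (S : Stmt L Var ar) : Stmt L Var ar

/-- A set of procedure declarations `P_i(u_i) :: S_i`, one for each procedure name `i : Fin n`. -/
structure Decls (L : FirstOrder.Language.{u, v}) (Var : Type w) {n : ℕ} (ar : Fin n → ℕ) :
    Type (max u v w) where
  /-- the formal parameters `u_i` -/
  params (i : Fin n) : Fin (ar i) ↪ Var
  /-- the body `S_i` -/
  body (i : Fin n) : Stmt L Var ar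

section Programs

variable {L : FirstOrder.Language.{u, v}} {Var : Type w} {n : ℕ} {ar : Fin n → ℕ}

/-- The generic call `P_i(u_i)`. -/
def Decls.genericCall (D : Decls L Var ar) (i : Fin n) : Stmt L Var ar :=
  .call i (fun j => Term.var (D.params i j))

/-- The substitution `[x := t]`, as a map from variables to expressions. -/
noncomputable def substMap {m : ℕ} (x : Fin m ↪ Var) (t : Fin m → L.Term Var) :
    Var → L.Term Var :=
  Function.extend x t Term.var

/-- The assertion `p[x := t]`. -/
noncomputable def Assertion.substitute {m : ℕ} (p : Assertion L Var) (x : Fin m ↪ Var)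
    (t : Fin m → L.Term Var) : Assertion L Var :=
  BoundedFormula.subst p (substMap x t)

/-- The assertion `∃ x₁, …, xₘ : p`: the variables `x` are turned into bound variables. -/
noncomputable def Assertion.existsVars {m : ℕ} (x : Fin m ↪ Var) (p : Assertion L Var) :
    Assertion L Var :=
  (show L.BoundedFormula Var m from
    BoundedFormula.relabel (Function.extend x Sum.inr Sum.inl : Var → Var ⊕ Fin m) p).exs

/-- `free(p)` -/
def Assertion.free [DecidableEq Var] (p : Assertion L Var) : Set Var :=
  ↑(BoundedFormula.freeVarFinset p)

/-- The variables occurring in a list of expressions. -/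
def termVars [DecidableEq Var] {m : ℕ} (t : Fin m → L.Term Var) : Set Var :=
  ⋃ j, ↑(t j).varFinset

/-- The variables occurring in a statement. -/
def Stmt.vars [DecidableEq Var] : Stmt L Var ar → Set Var
  | .skip => ∅
  | .assign x t => Set.range x ∪ termVars t
  | .call _ t => termVars t
  | .seq S₁ S₂ => S₁.vars ∪ S₂.vars
  | .ite B S₁ S₂ => Assertion.free B.1 ∪ S₁.vars ∪ S₂.vars
  | .while B S => Assertion.free B.1 ∪ S.vars
  | .block x t S => Set.range x ∪ termVars t ∪ S.vars

/-- `var(D | S)` -/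
def progVars [DecidableEq Var] (D : Decls L Var ar) (S : Stmt L Var ar) : Set Var :=
  (⋃ i, Set.range (D.params i) ∪ (D.body i).vars) ∪ S.vars

/-- The variables a statement can change, given the variables `c i` changed by calls of `P_i`. -/
def Stmt.changeWith (c : Fin n → Set Var) : Stmt L Var ar → Set Var
  | .skip => ∅
  | .assign x _ => Set.range x
  | .call i _ => c i
  | .seq S₁ S₂ => S₁.changeWith c ∪ S₂.changeWith c
  | .ite _ S₁ S₂ => S₁.changeWith c ∪ S₂.changeWith c
  | .while _ S => S.changeWith c
  | .block x _ S => S.changeWith c \ Set.range x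

/-- `change(D)`, the union of the sets `change(∅ | S_i)`, in which calls count for nothing. -/
def Decls.change (D : Decls L Var ar) : Set Var :=
  ⋃ i, (D.body i).changeWith (fun _ => ∅)

/-- `change(D | S)`, where `change(D | P_i(t)) = change(D) \ {u_i}`. -/
def progChange (D : Decls L Var ar) (S : Stmt L Var ar) : Set Var :=
  S.changeWith (fun i => D.change \ Set.range (D.params i))

/-- The size `l(S)` of a statement. -/
def Stmt.len : Stmt L Var ar → ℕ
  | .skip => 1
  | .assign _ _ => 1
  | .call _ _ => 1
  | .seq S₁ S₂ => S₁.len + S₂.len + 1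
  | .ite _ S₁ S₂ => S₁.len + S₂.len + 1
  | .while _ S => S.len + 1
  | .block _ _ S => (1 + S.len + 1) + 1

/-- The size `l(D | S) = l(D) + l(S)` of a program. -/
def progLen (D : Decls L Var ar) (S : Stmt L Var ar) : ℕ :=
  (∑ i, (D.body i).len) + S.len

end Programs

section Semantics

variable {L : FirstOrder.Language.{u, v}} {Var : Type w} {n : ℕ} {ar : Fin n → ℕ}

/-- `Exec M D S σ τ`: the program `(D | S)`, started in the state `σ`, terminates in `τ`. -/
inductive Exec (M : Type z) [L.Structure M] (D : Decls L Var ar) :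
    Stmt L Var ar → (Var → M) → (Var → M) → Prop where
  | skip (σ : Var → M) : Exec M D .skip σ σ
  | assign {m : ℕ} (x : Fin m ↪ Var) (t : Fin m → L.Term Var) (σ : Var → M) :
      Exec M D (.assign x t) σ (Function.extend x (fun j => (t j).realize σ) σ)
  | seq {S₁ S₂ : Stmt L Var ar} {σ ρ τ : Var → M} :
      Exec M D S₁ σ ρ → Exec M D S₂ ρ τ → Exec M D (.seq S₁ S₂) σ τ
  | iteTrue {B : BoolExpr L Var} {S₁ S₂ : Stmt L Var ar} {σ τ : Var → M} :
      B.1.Realize σ → Exec M D S₁ σ τ → Exec M D (.ite B S₁ S₂) σ τ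
  | iteFalse {B : BoolExpr L Var} {S₁ S₂ : Stmt L Var ar} {σ τ : Var → M} :
      ¬ B.1.Realize σ → Exec M D S₂ σ τ → Exec M D (.ite B S₁ S₂) σ τ
  | whileFalse {B : BoolExpr L Var} {S : Stmt L Var ar} {σ : Var → M} :
      ¬ B.1.Realize σ → Exec M D (.while B S) σ σ
  | whileTrue {B : BoolExpr L Var} {S : Stmt L Var ar} {σ ρ τ : Var → M} :
      B.1.Realize σ → Exec M D S σ ρ → Exec M D (.while B S) ρ τ → Exec M D (.while B S) σ τ
  /-- on leaving a block, its local variables get back the values they had before the block -/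
  | block {m : ℕ} {x : Fin m ↪ Var} {t : Fin m → L.Term Var} {S : Stmt L Var ar}
      {σ τ : Var → M} : Exec M D (.seq (.assign x t) S) σ τ →
      Exec M D (.block x t S) σ (Function.extend x (fun j => σ (x j)) τ)
  /-- call-by-value through inlining -/
  | call {i : Fin n} {t : Fin (ar i) → L.Term Var} {σ τ : Var → M} :
      Exec M D (.block (D.params i) t (D.body i)) σ τ → Exec M D (.call i t) σ τ

/-- The meaning of an assertion: the set of states in which it is true. -/
def meaning (M : Type z) [L.Structure M] (p : Assertion L Var) : Set (Var → M) :=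
  {σ | p.Realize σ}

/-- The assertion `p` is true in the interpretation `M`. -/
def TrueIn (M : Type z) [L.Structure M] (p : Assertion L Var) : Prop :=
  meaning M p = Set.univ

/-- The strongest postcondition `sp(p, S)`: all states that `(D | S)` can reach from a state
satisfying `p`. -/
def sp (M : Type z) [L.Structure M] (D : Decls L Var ar) (p : Assertion L Var)
    (S : Stmt L Var ar) : Set (Var → M) :=
  {τ | ∃ σ ∈ meaning M p, Exec M D S σ τ}

/-- `{p} S {q}` is true in `M` in the sense of partial correctness. -/
def Valid (M : Type z) [L.Structure M] (D : Decls L Var ar) (p : Assertion L Var)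
    (S : Stmt L Var ar) (q : Assertion L Var) : Prop :=
  sp M D p S ⊆ meaning M q

end Semantics

/-- `L` is expressive relative to `M`: for all assertions `p` and programs `(D | S)`, the strongest
postcondition is defined by a formula of `L`. -/
def Expressive (L : FirstOrder.Language.{u, v}) (Var : Type w) (M : Type z) [L.Structure M] : Prop :=
  ∀ (n : ℕ) (ar : Fin n → ℕ) (D : Decls L Var ar) (p : Assertion L Var) (S : Stmt L Var ar),
    ∃ φ : Assertion L Var, sp M D p S = meaning M φ

/-- The correctness formula `{pre} stmt {post}`. -/
structure CorrectnessFormula (L : FirstOrder.Language.{u, v}) (Var : Type w) {n : ℕ} (ar : Fin n → ℕ) :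
    Type (max u v w) where
  pre : Assertion L Var
  stmt : Stmt L Var ar
  post : Assertion L Var

/-- `cbv` is the full proof system; `core` is the system without the RECURSION rule. -/
inductive System : Type where
  | core
  | cbv

/-- Proofs (as trees), in the given system, of a correctness formula from a set `Φ` of correctness
formulas and all assertions true in `M`. -/
inductive Derivation {L : FirstOrder.Language.{u, v}} {Var : Type w} [DecidableEq Var] {n : ℕ}
    {ar : Fin n → ℕ} (M : Type z) [L.Structure M] (D : Decls L Var ar) :
    System → Set (CorrectnessFormula L Var ar) → CorrectnessFormula L Var ar →
      Type (max u v w) where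
  | assumption {s Φ} {f : CorrectnessFormula L Var ar} (hf : f ∈ Φ) : Derivation M D s Φ f
  | skip {s Φ} (p : Assertion L Var) : Derivation M D s Φ ⟨p, .skip, p⟩
  | assign {s Φ} {m : ℕ} (x : Fin m ↪ Var) (t : Fin m → L.Term Var) (p : Assertion L Var) :
      Derivation M D s Φ ⟨p.substitute x t, .assign x t, p⟩
  | composition {s Φ} {p r q : Assertion L Var} {S₁ S₂ : Stmt L Var ar} :
      Derivation M D s Φ ⟨p, S₁, r⟩ → Derivation M D s Φ ⟨r, S₂, q⟩ →
      Derivation M D s Φ ⟨p, .seq S₁ S₂, q⟩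
  | conditional {s Φ} {p q : Assertion L Var} {B : BoolExpr L Var} {S₁ S₂ : Stmt L Var ar} :
      Derivation M D s Φ ⟨p ⊓ B.1, S₁, q⟩ → Derivation M D s Φ ⟨p ⊓ B.1.not, S₂, q⟩ →
      Derivation M D s Φ ⟨p, .ite B S₁ S₂, q⟩
  | while {s Φ} {p : Assertion L Var} {B : BoolExpr L Var} {S : Stmt L Var ar} :
      Derivation M D s Φ ⟨p ⊓ B.1, S, p⟩ → Derivation M D s Φ ⟨p, .while B S, p ⊓ B.1.not⟩
  | block {s Φ} {p q : Assertion L Var} {m : ℕ} {x : Fin m ↪ Var} {t : Fin m → L.Term Var}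
      {S : Stmt L Var ar} (hq : Disjoint (Set.range x) q.free) :
      Derivation M D s Φ ⟨p, .seq (.assign x t) S, q⟩ → Derivation M D s Φ ⟨p, .block x t S, q⟩
  | procedureCall {s Φ} {p q : Assertion L Var} {i : Fin n} (t : Fin (ar i) → L.Term Var)
      (hq : Disjoint (Set.range (D.params i)) q.free) :
      Derivation M D s Φ ⟨p, D.genericCall i, q⟩ →
      Derivation M D s Φ ⟨p.substitute (D.params i) t, .call i t, q⟩
  | substitution {s Φ} {p q : Assertion L Var} {S : Stmt L Var ar} {m : ℕ} (x : Fin m ↪ Var)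
      (y : Fin m → Var) (hx : Disjoint (Set.range x) (progVars D S))
      (hy : Disjoint (Set.range y) (progChange D S)) :
      Derivation M D s Φ ⟨p, S, q⟩ →
      Derivation M D s Φ
        ⟨p.substitute x (fun j => Term.var (y j)), S, q.substitute x (fun j => Term.var (y j))⟩
  | invariance {s Φ} {r q : Assertion L Var} {S : Stmt L Var ar} (p : Assertion L Var)
      (hp : Disjoint p.free (progChange D S)) :
      Derivation M D s Φ ⟨r, S, q⟩ → Derivation M D s Φ ⟨p ⊓ r, S, p ⊓ q⟩
  | existsIntro {s Φ} {p q : Assertion L Var} {S : Stmt L Var ar} {m : ℕ} (x : Fin m ↪ Var)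
      (hx : Disjoint (Set.range x) (progVars D S ∪ q.free)) :
      Derivation M D s Φ ⟨p, S, q⟩ → Derivation M D s Φ ⟨p.existsVars x, S, q⟩
  | consequence {s Φ} {p p₁ q₁ q : Assertion L Var} {S : Stmt L Var ar}
      (hp : TrueIn M (p.imp p₁)) (hq : TrueIn M (q₁.imp q)) :
      Derivation M D s Φ ⟨p₁, S, q₁⟩ → Derivation M D s Φ ⟨p, S, q⟩
  /-- From the assumptions `{p_i} P_i(u_i) {q_i}`, one for each declared procedure, derive, without
  using RECURSION, both `{p} S {q}` and all `{p_i} S_i {q_i}`. -/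
  | recursion {Φ} {p q : Assertion L Var} {S : Stmt L Var ar} (pre post : Fin n → Assertion L Var)
      (hpost : ∀ i, Disjoint (Set.range (D.params i)) (post i).free) :
      Derivation M D .core (Set.range fun i => ⟨pre i, D.genericCall i, post i⟩) ⟨p, S, q⟩ →
      (∀ i, Derivation M D .core (Set.range fun i => ⟨pre i, D.genericCall i, post i⟩)
        ⟨pre i, D.body i, post i⟩) →
      Derivation M D .cbv Φ ⟨p, S, q⟩

/-- The number of applications of axioms and proof rules in a proof, subsidiary proofs included. -/
def Derivation.size {L : FirstOrder.Language.{u, v}} {Var : Type w} [DecidableEq Var] {n : ℕ}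
    {ar : Fin n → ℕ} {M : Type z} [L.Structure M] {D : Decls L Var ar} {s : System}
    {Φ : Set (CorrectnessFormula L Var ar)} {f : CorrectnessFormula L Var ar} :
    Derivation M D s Φ f → ℕ
  | .assumption _ => 0
  | .skip _ => 1
  | .assign _ _ _ => 1
  | .composition d₁ d₂ => d₁.size + d₂.size + 1
  | .conditional d₁ d₂ => d₁.size + d₂.size + 1
  | .while d => d.size + 1
  | .block _ d => d.size + 1
  | .procedureCall _ _ d => d.size + 1
  | .substitution _ _ _ _ d => d.size + 1
  | .invariance _ _ d => d.size + 1
  | .existsIntro _ _ d => d.size + 1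
  | .consequence _ _ d => d.size + 1
  | .recursion _ _ _ d e => d.size + (∑ i, (e i).size) + 1

/-- `Φ ⊢ᵏ {p} S {q}`: there is a proof in the full system from `Φ` and all assertions true in `M`
that consists of at most `k` applications of axioms and proof rules. -/
def ProvableIn {L : FirstOrder.Language.{u, v}} {Var : Type w} [DecidableEq Var] {n : ℕ}
    {ar : Fin n → ℕ} (M : Type z) [L.Structure M] (D : Decls L Var ar)
    (Φ : Set (CorrectnessFormula L Var ar)) (k : ℕ) (f : CorrectnessFormula L Var ar) : Prop :=
  ∃ d : Derivation M D .cbv Φ f, d.size ≤ k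

end CBV

open FirstOrder.Language

/-! ### Free variables under substitution, relabelling and quantification. -/

section FreeVariables

variable {L : FirstOrder.Language.{u, v}} {α β : Type*}

/-! Completeness rests on one most general formula per procedure. Let x list the program variables,
let z be fresh, and take {x = z} P_i(u_i) {G_i}, where G_i is ∃ u_i applied to a formula for the
strongest postcondition, given by expressiveness. G_i relates the initial values, kept in z, to the
final values of x outside u_i, which is all that can be needed about calls of P_i. The quantifier
yields the side condition of RECURSION; it also makes {x = z} S_i {G_i} true of the body, which
differs from the generic call only in not restoring u_i.

From these assumptions every true {p} S {q} with the variables of S among x has a recursion-free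
proof of size at most 6 l(S), by induction on S (`exists_derivation_core`), with strongest
postconditions as intermediate assertions. Three cases need an idea. For a call, copies of the entry
values in fresh variables let INVARIANCE carry p across, and six rules always suffice
(`exists_derivation_call`). For a block, fresh variables save the values of the locals
(`exists_derivation_block`). For a loop, an invariant comes from the strongest postcondition of a
modified loop (`exists_while_invariant`).

Each body is proved once, and all calls share the same assumptions. So the premises of RECURSION
cost at most 6 l(D | T) together, and RECURSION itself costs 1 ≤ l(T), whence C = 7. -/

theorem FirstOrder.Language.Term.varFinsetLeft_relabel_inl [DecidableEq α] {k : ℕ}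
    (t : L.Term α) : (t.relabel (Sum.inl : α → α ⊕ Fin k)).varFinsetLeft = t.varFinset := by
  induction t with
  | var => rfl
  | func f ts ih => simp [ih]

theorem FirstOrder.Language.Term.exists_of_mem_varFinsetLeft_subst [DecidableEq α] [DecidableEq β]
    {k : ℕ} (t : L.Term (α ⊕ Fin k)) (f : α → L.Term β) {b : β}
    (h : b ∈ (t.subst (Sum.elim (Term.relabel Sum.inl ∘ f)
      (Term.var ∘ Sum.inr) : α ⊕ Fin k → L.Term (β ⊕ Fin k))).varFinsetLeft) :
    ∃ a ∈ t.varFinsetLeft, b ∈ (f a).varFinset := by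
  induction t with
  | var i =>
    rcases i with a | i
    · exact ⟨a, by simp, by simpa [Term.varFinsetLeft_relabel_inl] using h⟩
    · simp at h
  | func g ts ih =>
    simp only [Term.subst, Term.varFinsetLeft, Finset.mem_biUnion, Finset.mem_univ, true_and] at h
    obtain ⟨i, hi⟩ := h
    obtain ⟨a, ha, hb⟩ := ih i hi
    exact ⟨a, by simpa using ⟨i, ha⟩, hb⟩

/-- Bound variables are indices, so nothing is captured and the quantifier case is immediate. This
controls the free variables in the side conditions of the proof rules. -/
theorem FirstOrder.Language.BoundedFormula.exists_of_mem_freeVarFinset_subst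
    [DecidableEq α] [DecidableEq β] {k : ℕ} (φ : L.BoundedFormula α k) (f : α → L.Term β) {b : β}
    (h : b ∈ (φ.subst f).freeVarFinset) :
    ∃ a ∈ φ.freeVarFinset, b ∈ (f a).varFinset := by
  induction φ with
  | falsum => simp [BoundedFormula.subst, BoundedFormula.mapTermRel] at h
  | equal t₁ t₂ =>
    simp only [BoundedFormula.subst, BoundedFormula.mapTermRel, BoundedFormula.freeVarFinset,
      Finset.mem_union] at h ⊢
    rcases h with h | h
    · obtain ⟨a, ha, hb⟩ := t₁.exists_of_mem_varFinsetLeft_subst f h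
      exact ⟨a, .inl ha, hb⟩
    · obtain ⟨a, ha, hb⟩ := t₂.exists_of_mem_varFinsetLeft_subst f h
      exact ⟨a, .inr ha, hb⟩
  | rel R ts =>
    simp only [BoundedFormula.subst, BoundedFormula.mapTermRel, BoundedFormula.freeVarFinset,
      Finset.mem_biUnion, Finset.mem_univ, true_and] at h ⊢
    obtain ⟨i, hi⟩ := h
    obtain ⟨a, ha, hb⟩ := (ts i).exists_of_mem_varFinsetLeft_subst f hi
    exact ⟨a, ⟨i, ha⟩, hb⟩
  | imp φ ψ ih₁ ih₂ =>
    simp only [BoundedFormula.subst, BoundedFormula.mapTermRel, BoundedFormula.freeVarFinset,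
      Finset.mem_union] at h ih₁ ih₂ ⊢
    rcases h with h | h
    · obtain ⟨a, ha, hb⟩ := ih₁ h
      exact ⟨a, .inl ha, hb⟩
    · obtain ⟨a, ha, hb⟩ := ih₂ h
      exact ⟨a, .inr ha, hb⟩
  | all φ ih => exact ih h

theorem FirstOrder.Language.Term.exists_of_mem_varFinsetLeft_relabel [DecidableEq β]
    {γ δ : Type*} (t : L.Term γ) (g : γ → β ⊕ δ) {b : β}
    (h : b ∈ (t.relabel g).varFinsetLeft) : ∃ a, g a = Sum.inl b := by
  induction t with
  | var i =>
    refine ⟨i, ?_⟩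
    simp only [Term.relabel] at h
    rcases hi : g i with a | j
    · rw [hi] at h
      simp at h
      rw [h]
    · rw [hi] at h
      simp at h
  | func g ts ih =>
    simp only [Term.relabel, Term.varFinsetLeft, Finset.mem_biUnion, Finset.mem_univ,
      true_and] at h
    obtain ⟨i, hi⟩ := h
    exact ih i hi

theorem FirstOrder.Language.Term.varFinsetLeft_relabel_map_id [DecidableEq α] {γ δ : Type*}
    (t : L.Term (α ⊕ γ)) (g : γ → δ) :
    (t.relabel (Sum.map id g)).varFinsetLeft = t.varFinsetLeft := by
  induction t with
  | var i => rcases i with a | i <;> simp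
  | func f ts ih => simp [ih]

/-- Under a quantifier `relabel` inserts a `castLE`, which has to be discarded. -/
theorem FirstOrder.Language.BoundedFormula.freeVarFinset_castLE [DecidableEq α] {k l : ℕ}
    (h : k ≤ l) (φ : L.BoundedFormula α k) : (φ.castLE h).freeVarFinset = φ.freeVarFinset := by
  induction φ generalizing l with
  | falsum => rfl
  | equal t₁ t₂ => simp [Term.varFinsetLeft_relabel_map_id]
  | rel R ts => simp [Term.varFinsetLeft_relabel_map_id]
  | imp φ ψ ih₁ ih₂ => simp [ih₁, ih₂]
  | all φ ih => simp [ih]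

theorem FirstOrder.Language.BoundedFormula.exists_of_mem_freeVarFinset_relabel [DecidableEq β]
    {k m : ℕ} (φ : L.BoundedFormula α k) (g : α → β ⊕ Fin m) {b : β}
    (h : b ∈ (φ.relabel g).freeVarFinset) : ∃ a, g a = Sum.inl b := by
  have aux : ∀ {j : ℕ} (t : L.Term (α ⊕ Fin j)),
      b ∈ (t.relabel (BoundedFormula.relabelAux g j)).varFinsetLeft → ∃ a, g a = Sum.inl b := by
    intro j t ht
    obtain ⟨c, hc⟩ := t.exists_of_mem_varFinsetLeft_relabel _ ht
    rcases c with a | i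
    · refine ⟨a, ?_⟩
      rcases ha : g a with d | d <;> simp [BoundedFormula.relabelAux, ha] at hc
      rw [hc]
    · simp [BoundedFormula.relabelAux] at hc
  induction φ with
  | falsum => simp [BoundedFormula.relabel, BoundedFormula.mapTermRel] at h
  | equal t₁ t₂ =>
    simp only [BoundedFormula.relabel, BoundedFormula.mapTermRel, BoundedFormula.freeVarFinset,
      Finset.mem_union] at h
    exact h.elim (aux t₁) (aux t₂)
  | rel R ts =>
    simp only [BoundedFormula.relabel, BoundedFormula.mapTermRel, BoundedFormula.freeVarFinset,
      Finset.mem_biUnion, Finset.mem_univ, true_and] at h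
    obtain ⟨i, hi⟩ := h
    exact aux _ hi
  | imp φ ψ ih₁ ih₂ =>
    simp only [BoundedFormula.relabel, BoundedFormula.mapTermRel, BoundedFormula.freeVarFinset,
      Finset.mem_union] at h ih₁ ih₂
    exact h.elim ih₁ ih₂
  | all φ ih =>
    simp only [BoundedFormula.relabel, BoundedFormula.mapTermRel, BoundedFormula.freeVarFinset,
      BoundedFormula.freeVarFinset_castLE] at h ih
    exact ih h

theorem FirstOrder.Language.BoundedFormula.freeVarFinset_exs [DecidableEq α] {k : ℕ}
    (φ : L.BoundedFormula α k) :
    BoundedFormula.freeVarFinset φ.exs = φ.freeVarFinset := by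
  induction k with
  | zero => rfl
  | succ k ih =>
    rw [BoundedFormula.exs, ih]
    simp

variable {M : Type z} [L.Structure M]

theorem FirstOrder.Language.Term.realize_congr_of_eqOn [DecidableEq α] {t : L.Term α}
    {σ τ : α → M} (h : Set.EqOn σ τ t.varFinset) : t.realize σ = t.realize τ := by
  induction t with
  | var a => exact h (by simp)
  | func f ts ih =>
    simp only [Term.realize_func]
    congr 1
    funext i
    refine ih i (h.mono ?_)
    intro a ha
    simpa using ⟨i, ha⟩

theorem FirstOrder.Language.Formula.realize_congr_of_eqOn [DecidableEq α] {p : L.Formula α}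
    {σ τ : α → M} (h : Set.EqOn σ τ (BoundedFormula.freeVarFinset p)) :
    p.Realize σ ↔ p.Realize τ := by
  unfold Formula.Realize
  rw [← BoundedFormula.realize_restrictFreeVar' (s := (BoundedFormula.freeVarFinset p : Set α))
    subset_rfl, ← BoundedFormula.realize_restrictFreeVar' (v := τ)
    (s := (BoundedFormula.freeVarFinset p : Set α)) subset_rfl]
  have hστ : σ ∘ (Subtype.val : ((BoundedFormula.freeVarFinset p : Set α)) → α) =
      τ ∘ Subtype.val := by
    funext a
    exact h a.2
  rw [hστ]

end FreeVariables

namespace CBV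

/-! ### Truth of assertions, their free variables, and fresh variables. -/

section Assertions

variable {L : FirstOrder.Language.{u, v}} {Var : Type w} {M : Type z} [L.Structure M]

theorem realize_substitute {m : ℕ} (p : Assertion L Var) (x : Fin m ↪ Var)
    (t : Fin m → L.Term Var) (σ : Var → M) :
    (p.substitute x t).Realize σ ↔ p.Realize (Function.extend x (fun j => (t j).realize σ) σ) := by
  unfold Formula.Realize Assertion.substitute
  rw [BoundedFormula.realize_subst]
  have : (fun a => (substMap x t a).realize σ) =
      Function.extend x (fun j => (t j).realize σ) σ := by
    funext a
    by_cases ha : ∃ j, x j = a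
    · obtain ⟨j, rfl⟩ := ha
      simp [substMap, x.injective.extend_apply]
    · simp [substMap, Function.extend_apply' _ _ _ ha]
  rw [this]

theorem realize_existsVars {m : ℕ} (p : Assertion L Var) (x : Fin m ↪ Var) (σ : Var → M) :
    (p.existsVars x).Realize σ ↔ ∃ d : Fin m → M, p.Realize (Function.extend x d σ) := by
  unfold Assertion.existsVars
  rw [BoundedFormula.realize_exs]
  refine exists_congr fun d => ?_
  erw [BoundedFormula.realize_relabel]
  unfold Formula.Realize
  have h₁ : Sum.elim σ (d ∘ Fin.castAdd 0) ∘ (Function.extend x Sum.inr Sum.inl) =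
      Function.extend x d σ := by
    funext a
    by_cases ha : ∃ j, x j = a
    · obtain ⟨j, rfl⟩ := ha
      simp [x.injective.extend_apply]
    · simp [Function.extend_apply' _ _ _ ha]
  rw [h₁]
  exact iff_of_eq (congrArg _ (Subsingleton.elim _ _))

/-- The assertion `x₁ = z₁ ∧ … ∧ xₘ = zₘ`. -/
def eqVars : {m : ℕ} → (Fin m → Var) → (Fin m → Var) → Assertion L Var
  | 0, _, _ => ⊤
  | _ + 1, x, y => Term.equal (Term.var (x 0)) (Term.var (y 0)) ⊓
      eqVars (fun j => x j.succ) fun j => y j.succ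

theorem realize_eqVars {m : ℕ} (x y : Fin m → Var) (σ : Var → M) :
    (eqVars (L := L) x y).Realize σ ↔ ∀ j, σ (x j) = σ (y j) := by
  induction m with
  | zero => simp [eqVars]
  | succ m ih => simp [eqVars, ih, Fin.forall_fin_succ]

theorem isQF_eqVars {m : ℕ} (x y : Fin m → Var) : (eqVars (L := L) x y).IsQF := by
  induction m with
  | zero => exact BoundedFormula.IsQF.top
  | succ m ih => exact (BoundedFormula.IsAtomic.equal _ _).isQF.inf (ih _ _)

/-- There are fresh lists of distinct variables of any length. -/
theorem exists_fresh [Infinite Var] (m : ℕ) {F : Set Var} (hF : F.Finite) :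
    ∃ y : Fin m ↪ Var, Disjoint (Set.range y) F := by
  have : Infinite ↥Fᶜ := hF.infinite_compl.to_subtype
  refine ⟨(Fin.valEmbedding.trans (Infinite.natEmbedding ↥Fᶜ)).trans (.subtype _), ?_⟩
  rw [Set.disjoint_left]
  rintro _ ⟨j, rfl⟩
  exact (Infinite.natEmbedding ↥Fᶜ j).2

theorem trueIn_imp {p q : Assertion L Var} :
    TrueIn M (p.imp q) ↔ ∀ σ : Var → M, p.Realize σ → q.Realize σ := by
  simp [TrueIn, meaning, Set.eq_univ_iff_forall]

variable [DecidableEq Var]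

theorem realize_congr {p : Assertion L Var} {σ τ : Var → M} (h : Set.EqOn σ τ p.free) :
    p.Realize σ ↔ p.Realize τ :=
  Formula.realize_congr_of_eqOn h

/-- Updating variables that are not free in an assertion does not affect its truth. -/
theorem realize_extend_of_disjoint {m : ℕ} {p : Assertion L Var} {x : Fin m ↪ Var}
    (h : Disjoint (Set.range x) p.free) (d : Fin m → M) (σ : Var → M) :
    p.Realize (Function.extend x d σ) ↔ p.Realize σ :=
  realize_congr fun _ ha => Function.extend_apply' _ _ _ fun ⟨j, hj⟩ =>
    h.ne_of_mem ⟨j, rfl⟩ ha hj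

theorem mem_free_subst {p : Assertion L Var} {f : Var → L.Term Var} {b : Var}
    (h : b ∈ Assertion.free (BoundedFormula.subst p f : Assertion L Var)) :
    ∃ a ∈ p.free, b ∈ (f a).varFinset :=
  BoundedFormula.exists_of_mem_freeVarFinset_subst p f h

/-- Renaming x to variables y outside x removes x from the free variables, as BLOCK demands;
renaming to variables outside u_i introduces no formal parameter, as PROCEDURE CALL demands. -/
theorem mem_free_substitute_var {m : ℕ} {p : Assertion L Var} {x : Fin m ↪ Var}
    {y : Fin m → Var} {b : Var} (h : b ∈ (p.substitute x fun j => Term.var (y j)).free) :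
    b ∈ p.free \ Set.range x ∨ b ∈ Set.range y := by
  obtain ⟨a, ha, hb⟩ := mem_free_subst h
  by_cases hax : ∃ j, x j = a
  · obtain ⟨j, rfl⟩ := hax
    right
    simp [substMap, x.injective.extend_apply] at hb
    exact ⟨j, hb.symm⟩
  · left
    simp [substMap, Function.extend_apply' _ _ _ hax] at hb
    subst hb
    exact ⟨ha, hax⟩

/-- Gives the side condition of RECURSION for the assertions G_i: a variable stays free only through
`Sum.inl`, and x is sent to `Sum.inr`. -/
theorem disjoint_free_existsVars {m : ℕ} (p : Assertion L Var) (x : Fin m ↪ Var) :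
    Disjoint (Set.range x) (p.existsVars x).free := by
  rw [Set.disjoint_left]
  rintro _ ⟨j, rfl⟩ h
  have h' : x j ∈ BoundedFormula.freeVarFinset (BoundedFormula.relabel
      (Function.extend x Sum.inr Sum.inl : Var → Var ⊕ Fin m) p) := by
    have := h
    unfold Assertion.free Assertion.existsVars at this
    rw [BoundedFormula.freeVarFinset_exs] at this
    exact this
  obtain ⟨a, ha⟩ := BoundedFormula.exists_of_mem_freeVarFinset_relabel _ _ h'
  by_cases hax : ∃ j, x j = a
  · obtain ⟨i, rfl⟩ := hax
    simp [x.injective.extend_apply] at ha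
  · rw [Function.extend_apply' _ _ _ hax, Sum.inl.injEq] at ha
    exact hax ⟨j, ha.symm⟩

theorem free_inf (p q : Assertion L Var) : Assertion.free (p ⊓ q) = p.free ∪ q.free := by
  simp [Assertion.free, Min.min, BoundedFormula.not, Bot.bot]

theorem free_eqVars_subset {m : ℕ} (x y : Fin m → Var) :
    (eqVars (L := L) x y).free ⊆ Set.range x ∪ Set.range y := by
  induction m with
  | zero => simp [eqVars, Assertion.free, Top.top, BoundedFormula.not, Bot.bot]
  | succ m ih =>
    rw [eqVars, free_inf]
    refine Set.union_subset ?_ ((ih _ _).trans ?_)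
    · intro a ha
      simp [Assertion.free, Term.equal, Term.bdEqual] at ha
      rcases ha with rfl | rfl
      · exact .inl ⟨0, rfl⟩
      · exact .inr ⟨0, rfl⟩
    · rintro a (⟨j, rfl⟩ | ⟨j, rfl⟩)
      · exact .inl ⟨_, rfl⟩
      · exact .inr ⟨_, rfl⟩

theorem finite_free (p : Assertion L Var) : p.free.Finite :=
  Finset.finite_toSet _

end Assertions

/-! ### Changed variables, locality of execution, and runs of blocks, calls and loops. -/

section Execution

variable {L : FirstOrder.Language.{u, v}} {Var : Type w} {n : ℕ} {ar : Fin n → ℕ}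

theorem Stmt.changeWith_subset {c : Fin n → Set Var} {E : Set Var} (h : ∀ i, c i ⊆ E)
    (S : Stmt L Var ar) : S.changeWith c ⊆ S.changeWith (fun _ => ∅) ∪ E := by
  induction S with
  | skip => simp [changeWith]
  | assign => exact Set.subset_union_left
  | call i => exact (h i).trans Set.subset_union_right
  | seq _ _ ih₁ ih₂ =>
    rintro a (ha | ha)
    · exact (ih₁ ha).imp_left .inl
    · exact (ih₂ ha).imp_left .inr
  | ite _ _ _ ih₁ ih₂ =>
    rintro a (ha | ha)
    · exact (ih₁ ha).imp_left .inl
    · exact (ih₂ ha).imp_left .inr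
  | block _ _ _ ih => exact fun a ha => (ih ha.1).imp_left fun h => ⟨h, ha.2⟩
  -- The remaining case is the loop.
  | _ =>
    rename_i ih
    exact ih

/-- This is why calls may be ignored in the definition of change(D): whatever a nested call
contributes lies in change(D) already. -/
theorem Decls.changeWith_body_subset (D : Decls L Var ar) (i : Fin n) :
    (D.body i).changeWith (fun j => D.change \ Set.range (D.params j)) ⊆ D.change := by
  refine ((D.body i).changeWith_subset fun j => Set.sdiff_subset).trans ?_
  exact Set.union_subset (Set.subset_iUnion
    (fun i => (D.body i).changeWith fun _ => ∅) i) subset_rfl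

theorem Stmt.changeWith_subset_vars [DecidableEq Var] {c : Fin n → Set Var} {E : Set Var}
    (h : ∀ i, c i ⊆ E) (S : Stmt L Var ar) : S.changeWith c ⊆ S.vars ∪ E := by
  induction S with
  | skip => simp [changeWith]
  | assign => exact Set.subset_union_left.trans Set.subset_union_left
  | call i => exact (h i).trans Set.subset_union_right
  | seq _ _ ih₁ ih₂ =>
    rintro a (ha | ha)
    · exact (ih₁ ha).imp_left .inl
    · exact (ih₂ ha).imp_left .inr
  | ite _ _ _ ih₁ ih₂ =>
    rintro a (ha | ha)
    · exact (ih₁ ha).imp_left fun h => .inl (.inr h)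
    · exact (ih₂ ha).imp_left .inr
  | block _ _ _ ih => exact fun a ha => (ih ha.1).imp_left .inr
  | _ =>
    rename_i ih
    exact fun a ha => (ih ha).imp_left .inr

theorem Decls.change_subset [DecidableEq Var] (D : Decls L Var ar) (S : Stmt L Var ar) :
    D.change ⊆ progVars D S := by
  refine Set.iUnion_subset fun i a ha => .inl (Set.mem_iUnion.2 ⟨i, .inr ?_⟩)
  exact ((D.body i).changeWith_subset_vars (fun _ => subset_rfl) ha).resolve_right id

/-- Hence variables fresh for the program meet the side conditions stated in terms of change(D | S).
-/
theorem progChange_subset_progVars [DecidableEq Var] (D : Decls L Var ar) (S : Stmt L Var ar) :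
    progChange D S ⊆ progVars D S := by
  refine (S.changeWith_subset_vars fun i => Set.sdiff_subset).trans ?_
  exact Set.union_subset Set.subset_union_right (D.change_subset S)

theorem finite_termVars [DecidableEq Var] {m : ℕ} (t : Fin m → L.Term Var) :
    (termVars t).Finite :=
  Set.finite_iUnion fun _ => Finset.finite_toSet _

theorem Stmt.finite_vars [DecidableEq Var] (S : Stmt L Var ar) : S.vars.Finite := by
  induction S with
  | skip => exact Set.finite_empty
  | assign => exact (Set.finite_range _).union (finite_termVars _)
  | call => exact finite_termVars _
  | seq _ _ ih₁ ih₂ => exact ih₁.union ih₂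
  | ite B _ _ ih₁ ih₂ => exact ((finite_free B.1).union ih₁).union ih₂
  | block _ _ _ ih => exact ((Set.finite_range _).union (finite_termVars _)).union ih
  | _ =>
    rename_i B S ih
    exact (finite_free B.1).union ih

theorem finite_progVars [DecidableEq Var] (D : Decls L Var ar) (S : Stmt L Var ar) :
    (progVars D S).Finite :=
  (Set.finite_iUnion fun i => (Set.finite_range _).union (D.body i).finite_vars).union
    S.finite_vars

theorem params_subset_progVars [DecidableEq Var] (D : Decls L Var ar) (S : Stmt L Var ar)
    (i : Fin n) : Set.range (D.params i) ⊆ progVars D S := fun _ ha =>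
  .inl (Set.mem_iUnion.2 ⟨i, .inl ha⟩)

theorem body_vars_subset_progVars [DecidableEq Var] (D : Decls L Var ar) (S : Stmt L Var ar)
    (i : Fin n) : (D.body i).vars ⊆ progVars D S := fun _ ha =>
  .inl (Set.mem_iUnion.2 ⟨i, .inr ha⟩)

variable {M : Type z} [L.Structure M] {D : Decls L Var ar}

theorem extend_apply_of_notMem {m : ℕ} {x : Fin m ↪ Var} {a : Var} (h : a ∉ Set.range x)
    (d : Fin m → M) (σ : Var → M) : Function.extend x d σ a = σ a :=
  Function.extend_apply' _ _ _ h

theorem extend_comp_self {m : ℕ} (x : Fin m ↪ Var) (σ : Var → M) :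
    Function.extend x (fun j => σ (x j)) σ = σ := by
  funext a
  by_cases ha : a ∈ Set.range x
  · obtain ⟨j, rfl⟩ := ha
    simp [x.injective.extend_apply]
  · exact extend_apply_of_notMem ha _ _

theorem eqOn_extend {m : ℕ} {x : Fin m ↪ Var} {d : Fin m → M} {σ τ : Var → M} {W : Set Var}
    (h : Set.EqOn σ τ W) : Set.EqOn (Function.extend x d σ) (Function.extend x d τ) W := by
  intro a ha
  by_cases hx : a ∈ Set.range x
  · obtain ⟨j, rfl⟩ := hx
    simp [x.injective.extend_apply]
  · rw [extend_apply_of_notMem hx, extend_apply_of_notMem hx, h ha]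

/-- A program changes no variable outside `change(D | S)`. -/
theorem Exec.eq_of_notMem_progChange {S : Stmt L Var ar} {σ τ : Var → M} (h : Exec M D S σ τ)
    {a : Var} (ha : a ∉ progChange D S) : τ a = σ a := by
  unfold progChange at ha
  induction h with
  | skip => rfl
  | assign => exact extend_apply_of_notMem ha _ _
  | seq _ _ ih₁ ih₂ => exact (ih₂ fun h => ha (.inr h)).trans (ih₁ fun h => ha (.inl h))
  | iteTrue _ _ ih => exact ih fun h => ha (.inl h)
  | iteFalse _ _ ih => exact ih fun h => ha (.inr h)
  | whileFalse => rfl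
  | whileTrue _ _ _ ih₁ ih₂ => exact (ih₂ ha).trans (ih₁ ha)
  | @block m x _ _ σ _ _ ih =>
    by_cases hx : a ∈ Set.range x
    · obtain ⟨j, rfl⟩ := hx
      simp [x.injective.extend_apply]
    · rw [extend_apply_of_notMem hx]
      exact ih fun h => h.elim hx fun h => ha ⟨h, hx⟩
  | call _ ih => exact ih fun h => ha ⟨D.changeWith_body_subset _ h.1, h.2⟩

/-- The behaviour of a program depends only on the values of its variables. -/
theorem Exec.exists_eqOn [DecidableEq Var] {W : Set Var} (hp : ∀ i, Set.range (D.params i) ⊆ W)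
    (hb : ∀ i, (D.body i).vars ⊆ W) {S : Stmt L Var ar} {σ τ : Var → M} (h : Exec M D S σ τ)
    (hS : S.vars ⊆ W) {σ' : Var → M} (hσ : Set.EqOn σ σ' W) :
    ∃ τ', Exec M D S σ' τ' ∧ Set.EqOn τ τ' W := by
  have terms : ∀ {m : ℕ} {t : Fin m → L.Term Var} {σ σ' : Var → M}, termVars t ⊆ W →
      Set.EqOn σ σ' W → (fun j => (t j).realize σ) = fun j => (t j).realize σ' :=
    fun ht hσ => funext fun j => Term.realize_congr_of_eqOn (hσ.mono
      ((Set.subset_iUnion (fun j => ((_ : L.Term Var).varFinset : Set Var)) j).trans ht))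
  induction h generalizing σ' with
  | skip => exact ⟨_, .skip _, hσ⟩
  | assign x t σ =>
    refine ⟨_, .assign x t σ', ?_⟩
    rw [terms (Set.subset_union_right.trans hS) hσ]
    exact eqOn_extend hσ
  | seq _ _ ih₁ ih₂ =>
    obtain ⟨ρ, h₁, hρ⟩ := ih₁ (Set.subset_union_left.trans hS) hσ
    obtain ⟨τ, h₂, hτ⟩ := ih₂ (Set.subset_union_right.trans hS) hρ
    exact ⟨τ, h₁.seq h₂, hτ⟩
  | iteTrue hB _ ih =>
    obtain ⟨τ, h, hτ⟩ := ih
      ((Set.subset_union_right.trans Set.subset_union_left).trans hS) hσ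
    refine ⟨τ, .iteTrue ((realize_congr (hσ.mono ?_)).1 hB) h, hτ⟩
    exact (Set.subset_union_left.trans Set.subset_union_left).trans hS
  | iteFalse hB _ ih =>
    obtain ⟨τ, h, hτ⟩ := ih (Set.subset_union_right.trans hS) hσ
    refine ⟨τ, .iteFalse (fun h => hB ((realize_congr (hσ.mono ?_)).2 h)) h, hτ⟩
    exact (Set.subset_union_left.trans Set.subset_union_left).trans hS
  | whileFalse hB =>
    refine ⟨_, .whileFalse (fun h => hB ((realize_congr (hσ.mono ?_)).2 h)), hσ⟩
    exact Set.subset_union_left.trans hS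
  | whileTrue hB _ _ ih₁ ih₂ =>
    obtain ⟨ρ, h₁, hρ⟩ := ih₁ (Set.subset_union_right.trans hS) hσ
    obtain ⟨τ, h₂, hτ⟩ := ih₂ hS hρ
    refine ⟨τ, .whileTrue ((realize_congr (hσ.mono ?_)).1 hB) h₁ h₂, hτ⟩
    exact Set.subset_union_left.trans hS
  | @block _ x t S σ τ _ ih =>
    obtain ⟨τ', h, hτ⟩ := ih hS hσ
    refine ⟨_, .block h, ?_⟩
    have : (fun j => σ (x j)) = fun j => σ' (x j) := funext fun j =>
      hσ (hS (.inl (.inl ⟨j, rfl⟩)))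
    rw [this]
    exact eqOn_extend hτ
  | call _ ih =>
    obtain ⟨τ, h, hτ⟩ := ih (Set.union_subset (Set.union_subset (hp _) hS) (hb _)) hσ
    exact ⟨τ, h.call, hτ⟩

theorem exec_block_iff {m : ℕ} {x : Fin m ↪ Var} {t : Fin m → L.Term Var} {S : Stmt L Var ar}
    {σ τ : Var → M} : Exec M D (.block x t S) σ τ ↔
      ∃ ρ, Exec M D S (Function.extend x (fun j => (t j).realize σ) σ) ρ ∧
        τ = Function.extend x (fun j => σ (x j)) ρ := by
  constructor
  · intro h
    cases h with
    | block h =>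
      cases h with
      | seq h₁ h₂ =>
        cases h₁ with
        | assign => exact ⟨_, h₂, rfl⟩
  · rintro ⟨ρ, h, rfl⟩
    exact .block ((Exec.assign x t σ).seq h)

theorem exec_call_iff {i : Fin n} {t : Fin (ar i) → L.Term Var} {σ τ : Var → M} :
    Exec M D (.call i t) σ τ ↔
      ∃ ρ, Exec M D (D.body i) (Function.extend (D.params i) (fun j => (t j).realize σ) σ) ρ ∧
        τ = Function.extend (D.params i) (fun j => σ (D.params i j)) ρ := by
  rw [← exec_block_iff]
  exact ⟨fun | .call h => h, .call⟩

/-- Passing the formals to themselves assigns nothing, so body and call start in the same state. -/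
theorem exec_genericCall_iff {i : Fin n} {σ τ : Var → M} :
    Exec M D (D.genericCall i) σ τ ↔ ∃ ρ, Exec M D (D.body i) σ ρ ∧
      τ = Function.extend (D.params i) (fun j => σ (D.params i j)) ρ := by
  rw [Decls.genericCall, exec_call_iff]
  simp only [Term.realize_var, extend_comp_self]

theorem valid_iff {p q : Assertion L Var} {S : Stmt L Var ar} :
    Valid M D p S q ↔ ∀ σ τ, p.Realize σ → Exec M D S σ τ → q.Realize τ :=
  ⟨fun h σ _ hσ e => h ⟨σ, hσ, e⟩, fun h τ ⟨σ, hσ, e⟩ => h σ τ hσ e⟩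

theorem realize_iff_of_sp_eq {p φ : Assertion L Var} {S : Stmt L Var ar}
    (h : sp M D p S = meaning M φ) (τ : Var → M) :
    φ.Realize τ ↔ ∃ σ, p.Realize σ ∧ Exec M D S σ τ :=
  (Set.ext_iff.1 h τ).symm

/-- The exit test is dropped on purpose: only reachability at the loop head matters for the
invariant. -/
theorem Exec.while_reflTransGen {B : BoolExpr L Var} {S : Stmt L Var ar} {σ τ : Var → M}
    (h : Exec M D (.while B S) σ τ) :
    Relation.ReflTransGen (fun σ τ => B.1.Realize σ ∧ Exec M D S σ τ) σ τ := by
  generalize hT : Stmt.while B S = T at h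
  induction h with
  | whileFalse => exact .refl
  | whileTrue hB e _ _ ih =>
    cases hT
    exact .head ⟨hB, e⟩ (ih rfl)
  | _ => cases hT

theorem Stmt.one_le_len (S : Stmt L Var ar) : 1 ≤ S.len := by
  cases S <;> simp [Stmt.len]

end Execution

/-! ### Linear-size completeness. -/

section Completeness

variable {L : FirstOrder.Language.{u, v}} {Var : Type w} [DecidableEq Var] {M : Type z}
  [L.Structure M] {n : ℕ} {ar : Fin n → ℕ} {D : Decls L Var ar}

/-- A valid correctness formula for a call follows in six steps from the most general one for the
generic call, which starts from `x = z` for fresh `z`, where `x` lists the program variables. -/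
theorem exists_derivation_call [Infinite Var] {N : ℕ} {x z : Fin N ↪ Var}
    (hp : ∀ i, Set.range (D.params i) ⊆ Set.range x) (hb : ∀ i, (D.body i).vars ⊆ Set.range x)
    (hz : Disjoint (Set.range z) (Set.range x)) {i : Fin n} {G : Assertion L Var}
    (hGu : Disjoint (Set.range (D.params i)) G.free)
    (hG : ∀ τ : Var → M, G.Realize τ → ∃ (d : Fin (ar i) → M) (σ : Var → M),
      (∀ j, σ (x j) = σ (z j)) ∧
        Exec M D (D.genericCall i) σ (Function.extend (D.params i) d τ))
    {Φ : Set (CorrectnessFormula L Var ar)} (hΦ : ⟨eqVars x z, D.genericCall i, G⟩ ∈ Φ)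
    {t : Fin (ar i) → L.Term Var} (ht : termVars t ⊆ Set.range x) {p q : Assertion L Var}
    (h : Valid M D p (.call i t) q) :
    ∃ d : Derivation M D .core Φ ⟨p, .call i t, q⟩, d.size ≤ 6 := by
  classical
  have hprog : ∀ {S : Stmt L Var ar}, S.vars ⊆ Set.range x → progVars D S ⊆ Set.range x :=
    fun hS => Set.union_subset (Set.iUnion_subset fun i => Set.union_subset (hp i) (hb i)) hS
  have hgen : progVars D (D.genericCall i) ⊆ Set.range x := by
    refine hprog (Set.iUnion_subset fun j a ha => hp i ⟨j, ?_⟩)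
    exact (Finset.mem_singleton.1 ha).symm
  have hcall : progVars D (.call i t) ⊆ Set.range x := hprog ht
  -- The variables z may occur in p and q, so they are renamed to z' fresh for both.
  obtain ⟨z', hz'⟩ := exists_fresh (Var := Var) N (F := Set.range x ∪ p.free ∪ q.free)
    (((Set.finite_range x).union (finite_free p)).union (finite_free q))
  simp only [Set.disjoint_union_right] at hz'
  obtain ⟨⟨hz'x, hz'p⟩, hz'q⟩ := hz'
  have xz : ∀ j, x j ∉ Set.range z := fun j hj => hz.ne_of_mem hj ⟨j, rfl⟩ rfl
  have xz' : ∀ j, x j ∉ Set.range z' := fun j hj => hz'x.ne_of_mem hj ⟨j, rfl⟩ rfl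
  have z'u : ∀ j, z' j ∉ Set.range (D.params i) := fun j hj =>
    hz'x.ne_of_mem ⟨j, rfl⟩ (hp i hj) rfl
  set u := D.params i with hu
  set A : Assertion L Var := (eqVars x z : Assertion L Var).substitute z (fun j => Term.var (z' j))
    with hA
  set G' := G.substitute z (fun j => Term.var (z' j)) with hG'
  -- E is (x = z')[u := t]: z' holds the values of x on entry to the body.
  set E := A.substitute u t with hE
  have realizeE : ∀ σ : Var → M, E.Realize σ ↔
      ∀ j, Function.extend u (fun j => (t j).realize σ) σ (x j) = σ (z' j) := by
    intro σ
    rw [hE, realize_substitute, hA, realize_substitute, realize_eqVars]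
    refine forall_congr' fun j => ?_
    rw [extend_apply_of_notMem (xz j), z.injective.extend_apply, Term.realize_var,
      extend_apply_of_notMem (z'u j)]
  let c : Set Var := progChange D (.call i t)
  have hcx : c ⊆ Set.range x := (progChange_subset_progVars D _).trans hcall
  have hcu : ∀ a ∈ c, a ∉ Set.range u := fun a ha => ha.2
  -- Each changed variable is replaced by its copy. Changed variables are not formals, so under E
  -- the copy equals the value before the call.
  let f : Var → Var := fun a => if a ∈ c then Function.extend x z' id a else a
  have hfc : ∀ a, f a ∉ c := by
    intro a hfa
    by_cases ha : a ∈ c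
    · obtain ⟨j, rfl⟩ := hcx ha
      simp only [f, if_pos ha, x.injective.extend_apply] at hfa
      exact hz'x.ne_of_mem ⟨j, rfl⟩ (hcx hfa) rfl
    · simp only [f, if_neg ha] at hfa
      exact ha hfa
  -- E is carried across along with p, because t may contain changed variables and its initial
  -- values are needed again after the call.
  set inv : Assertion L Var := BoundedFormula.subst (p ⊓ E) (fun a => Term.var (f a)) with hinv
  have realize_inv : ∀ σ : Var → M, inv.Realize σ ↔ p.Realize (σ ∘ f) ∧ E.Realize (σ ∘ f) := by
    intro σ
    rw [← Formula.realize_inf]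
    exact BoundedFormula.realize_subst
  have inv_free : Disjoint inv.free (progChange D (.call i t)) := by
    rw [Set.disjoint_left]
    intro a ha hac
    obtain ⟨b, -, hb⟩ := mem_free_subst ha
    rw [Term.varFinset, Finset.mem_singleton] at hb
    exact hfc b (hb ▸ hac)
  have hG'u : Disjoint (Set.range u) G'.free := by
    rw [Set.disjoint_right]
    intro a ha hau
    rcases mem_free_substitute_var ha with ha | ⟨j, rfl⟩
    · exact hGu.ne_of_mem hau ha.1 rfl
    · exact z'u j hau
  have pre : TrueIn M ((p ⊓ E).imp (inv ⊓ E)) := by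
    refine trueIn_imp.2 fun σ hσ => ?_
    rw [Formula.realize_inf] at hσ ⊢
    refine ⟨(realize_inv σ).2 ?_, hσ.2⟩
    suffices σ ∘ f = σ by rwa [this]
    funext a
    by_cases ha : a ∈ c
    · obtain ⟨j, rfl⟩ := hcx ha
      simp only [Function.comp_apply, f, if_pos ha, x.injective.extend_apply]
      rw [← (realizeE σ).1 hσ.2 j, extend_apply_of_notMem (hcu _ ha)]
    · simp only [Function.comp_apply, f, if_neg ha]
  -- In a final state τ, the state τ ∘ f is a possible initial state. G' gives a run of the body
  -- from a state that agrees on x with τ ∘ f after u := t; transferring this run yields a run of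
  -- the call from τ ∘ f to τ, and validity applies.
  have post : TrueIn M ((inv ⊓ G').imp q) := by
    refine trueIn_imp.2 fun τ hτ => ?_
    rw [Formula.realize_inf, realize_inv] at hτ
    obtain ⟨⟨hpσ, hEσ⟩, hτ⟩ := hτ
    obtain ⟨d, σ, hσ, hex⟩ := hG _ ((realize_substitute _ _ _ _).1 hτ)
    rw [realizeE] at hEσ
    simp only [Term.realize_var] at hex
    have fz' : ∀ j, f (z' j) = z' j := fun j => by
      have : z' j ∉ c := fun h => hz'x.ne_of_mem ⟨j, rfl⟩ (hcx h) rfl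
      simp only [f, if_neg this]
    have fixed : ∀ j, σ (z j) = τ (z' j) := by
      intro j
      have hzc : z j ∉ Set.range x := fun h => hz.ne_of_mem ⟨j, rfl⟩ h rfl
      rw [← hex.eq_of_notMem_progChange (fun h => hzc (hgen (progChange_subset_progVars D _ h))),
        extend_apply_of_notMem (fun h => hzc (hp i h)), z.injective.extend_apply]
    obtain ⟨ρ, hρ, hτρ⟩ := exec_genericCall_iff.1 hex
    have start : Set.EqOn σ (Function.extend u (fun j => (t j).realize (τ ∘ f)) (τ ∘ f))
        (Set.range x) := by
      rintro _ ⟨j, rfl⟩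
      rw [hσ j, fixed j, hEσ j, Function.comp_apply, fz']
    obtain ⟨ρ', hρ', hρρ'⟩ := hρ.exists_eqOn hp hb (hb i) start
    refine valid_iff.1 h (τ ∘ f) τ hpσ ?_
    have hrun := exec_call_iff.2 ⟨ρ', hρ', rfl⟩
    convert hrun using 1
    funext a
    by_cases hac : a ∈ c
    · have hau := hcu a hac
      obtain ⟨j, rfl⟩ := hcx hac
      rw [extend_apply_of_notMem hau, ← hρρ' ⟨j, rfl⟩]
      have := congrFun hτρ (x j)
      rwa [extend_apply_of_notMem hau, extend_apply_of_notMem hau,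
        extend_apply_of_notMem (xz j)] at this
    · rw [hrun.eq_of_notMem_progChange hac]
      simp only [Function.comp_apply, f, if_neg hac]
  have final : TrueIn M (p.imp ((p ⊓ E).existsVars z')) := by
    refine trueIn_imp.2 fun σ hσ => ?_
    rw [realize_existsVars]
    refine ⟨fun j => Function.extend u (fun j => (t j).realize σ) σ (x j), ?_⟩
    set σ' := Function.extend z'
      (fun j => Function.extend u (fun j => (t j).realize σ) σ (x j)) σ with hσ'
    rw [Formula.realize_inf, realizeE]
    refine ⟨(realize_extend_of_disjoint hz'p _ _).2 hσ, fun j => ?_⟩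
    have hx : Set.EqOn σ' σ (Set.range x) := by
      rintro _ ⟨j, rfl⟩
      exact extend_apply_of_notMem (xz' j) _ _
    have htσ : (fun j => (t j).realize σ') = fun j => (t j).realize σ := funext fun j =>
      Term.realize_congr_of_eqOn (hx.mono
        ((Set.subset_iUnion (fun j => ((t j).varFinset : Set Var)) j).trans ht))
    rw [htσ, eqOn_extend hx ⟨j, rfl⟩, hσ', z'.injective.extend_apply]
  have hz'E : Disjoint (Set.range z') (progVars D (.call i t) ∪ q.free) :=
    Set.disjoint_union_right.2 ⟨hz'x.mono_right hcall, hz'q⟩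
  -- From the inside: SUBSTITUTION, PROCEDURE CALL, INVARIANCE, consequence, ∃-INTRODUCTION,
  -- consequence. The assumption itself counts as zero.
  refine ⟨.consequence final (trueIn_imp.2 fun _ => id) (.existsIntro z' hz'E
    (.consequence pre post (.invariance inv inv_free (.procedureCall t hG'u
      (.substitution z (fun j => z' j) (hz.mono_right hgen)
        (hz'x.mono_right ((progChange_subset_progVars D _).trans hgen)) (.assumption hΦ)))))), ?_⟩
  simp [Derivation.size]

/-- The set of program variables can be listed without repetitions. -/
theorem exists_range_eq_progVars (D : Decls L Var ar) (S : Stmt L Var ar) :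
    ∃ (N : ℕ) (x : Fin N ↪ Var), Set.range x = progVars D S := by
  have hfin := finite_progVars D S
  refine ⟨hfin.toFinset.card, hfin.toFinset.equivFin.symm.toEmbedding.trans (.subtype _), ?_⟩
  ext a
  constructor
  · rintro ⟨j, rfl⟩
    exact hfin.mem_toFinset.1 (hfin.toFinset.equivFin.symm j).2
  · exact fun ha => ⟨hfin.toFinset.equivFin ⟨a, hfin.mem_toFinset.2 ha⟩, by simp⟩

/-- A loop invariant that holds exactly in the states that the loop can reach from `p`. -/
theorem exists_while_invariant [Infinite Var] (hexp : Expressive L Var M) {p q : Assertion L Var}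
    {B : BoolExpr L Var} {S : Stmt L Var ar} (h : Valid M D p (.while B S) q) :
    ∃ r : Assertion L Var, TrueIn M (p.imp r) ∧ Valid M D (r ⊓ B.1) S r ∧
      TrueIn M ((r ⊓ B.1.not).imp q) := by
  obtain ⟨N, x, hx⟩ := exists_range_eq_progVars D S
  obtain ⟨z, hz⟩ := exists_fresh N (F := Set.range x ∪ p.free ∪ Assertion.free B.1)
    (((Set.finite_range x).union (finite_free p)).union (finite_free B.1))
  simp only [Set.disjoint_union_right] at hz
  obtain ⟨⟨hzx, hzp⟩, hzB⟩ := hz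
  have xz : ∀ j, x j ∉ Set.range z := fun j hj => hzx.ne_of_mem hj ⟨j, rfl⟩ rfl
  -- Strongest postconditions describe final states only. A loop that also stops when x = z makes
  -- every state reached at the loop head final, for a suitable value of z; quantifying z away gives
  -- the invariant.
  let B' : BoolExpr L Var := ⟨B.1 ⊓ (eqVars x z : Assertion L Var).not,
    B.2.inf (isQF_eqVars x z).not⟩
  have hB' : ∀ σ : Var → M, B'.1.Realize σ ↔ B.1.Realize σ ∧ ¬ ∀ j, σ (x j) = σ (z j) := by
    intro σ
    simp only [B', Formula.realize_inf, Formula.realize_not, realize_eqVars]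
  let R : (Var → M) → (Var → M) → Prop := fun σ τ => B.1.Realize σ ∧ Exec M D S σ τ
  have outside : ∀ {σ τ : Var → M}, Exec M D S σ τ → ∀ a ∉ Set.range x, τ a = σ a :=
    fun e a ha => e.eq_of_notMem_progChange
      fun h => ha (hx ▸ progChange_subset_progVars D S h)
  have update : ∀ {σ τ : Var → M} (d : Fin N → M), Exec M D S σ τ →
      Exec M D S (Function.extend z d σ) (Function.extend z d τ) := by
    intro σ τ d e
    have hEq : ∀ σ : Var → M, Set.EqOn σ (Function.extend z d σ) (Set.range x) := by
      rintro σ _ ⟨j, rfl⟩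
      exact (extend_apply_of_notMem (xz j) _ _).symm
    obtain ⟨τ', e', hτ'⟩ := e.exists_eqOn (W := Set.range x)
      (fun i => hx ▸ params_subset_progVars D S i)
      (fun i => hx ▸ body_vars_subset_progVars D S i)
      (hx ▸ Set.subset_union_right) (hEq σ)
    convert e' using 1
    funext a
    by_cases ha : a ∈ Set.range x
    · rw [← hEq τ ha, hτ' ha]
    · rw [outside e' a ha]
      by_cases haz : a ∈ Set.range z
      · obtain ⟨j, rfl⟩ := haz
        simp [z.injective.extend_apply]
      · rw [extend_apply_of_notMem haz, extend_apply_of_notMem haz, outside e a ha]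
  obtain ⟨φ, hφ⟩ := hexp n ar D p (.while B' S)
  have hr : ∀ τ : Var → M, Formula.Realize (φ.existsVars z) τ ↔
      ∃ σ, p.Realize σ ∧ Relation.ReflTransGen R σ τ := by
    intro τ
    rw [realize_existsVars]
    constructor
    · rintro ⟨d, hd⟩
      obtain ⟨σ, hσ, e⟩ := (realize_iff_of_sp_eq hφ _).1 hd
      -- The run found has z = d; giving z its value in τ throughout turns it into a chain of
      -- iterations ending in τ.
      refine ⟨Function.extend z (fun j => τ (z j)) σ,
        (realize_extend_of_disjoint hzp _ _).2 hσ, ?_⟩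
      have back : Function.extend z (fun j => τ (z j)) (Function.extend z d τ) = τ := by
        funext a
        by_cases ha : a ∈ Set.range z
        · obtain ⟨j, rfl⟩ := ha
          simp [z.injective.extend_apply]
        · rw [extend_apply_of_notMem ha, extend_apply_of_notMem ha]
      have lifted := e.while_reflTransGen.lift (p := R)
        (Function.extend z (fun j => τ (z j))) fun ρ ρ' hρ =>
          ⟨(realize_extend_of_disjoint hzB _ _).2 ((hB' _).1 hρ.1).1, update _ hρ.2⟩
      rwa [Function.onFun, back] at lifted
    · rintro ⟨σ, hσ, hστ⟩
      have outside' : ∀ {σ : Var → M}, Relation.ReflTransGen R σ τ →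
          ∀ a ∉ Set.range x, τ a = σ a := by
        intro σ h a ha
        induction h using Relation.ReflTransGen.head_induction_on with
        | refl => rfl
        | head h₁ _ ih => exact ih.trans (outside h₁.2 a ha)
      -- With the values of x in τ stored in z, the modified loop stops on reaching τ.
      refine ⟨fun j => τ (x j), (realize_iff_of_sp_eq hφ _).2
        ⟨Function.extend z (fun j => τ (x j)) σ, (realize_extend_of_disjoint hzp _ _).2 hσ, ?_⟩⟩
      clear hσ
      induction hστ using Relation.ReflTransGen.head_induction_on with
      | refl =>
        refine .whileFalse fun hB => ((hB' _).1 hB).2 fun j => ?_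
        rw [extend_apply_of_notMem (xz j), z.injective.extend_apply]
      | @head σ ρ h₁ h₂ ih =>
        have hB := (realize_extend_of_disjoint hzB (fun j => τ (x j)) σ).2 h₁.1
        -- The chain may pass through τ before its end. The modified loop then stops early, but in
        -- the right state, since nothing outside x changes.
        by_cases hσ : ∀ j, σ (x j) = τ (x j)
        · obtain rfl : σ = τ := by
            funext a
            by_cases ha : a ∈ Set.range x
            · obtain ⟨j, rfl⟩ := ha
              exact hσ j
            · exact (outside' (h₂.head h₁) a ha).symm
          refine .whileFalse fun hB => ((hB' _).1 hB).2 fun j => ?_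
          rw [extend_apply_of_notMem (xz j), z.injective.extend_apply]
        · refine .whileTrue ((hB' _).2 ⟨hB, fun h => hσ fun j => ?_⟩) (update _ h₁.2) ih
          have := h j
          rwa [extend_apply_of_notMem (xz j), z.injective.extend_apply] at this
  refine ⟨φ.existsVars z, ?_, ?_, ?_⟩
  · exact trueIn_imp.2 fun σ hσ => (hr σ).2 ⟨σ, hσ, .refl⟩
  · refine valid_iff.2 fun σ τ hσ e => ?_
    rw [Formula.realize_inf, hr] at hσ
    obtain ⟨⟨ρ, hρ, hρσ⟩, hB⟩ := hσ
    exact (hr τ).2 ⟨ρ, hρ, hρσ.tail ⟨hB, e⟩⟩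
  · refine trueIn_imp.2 fun τ hτ => ?_
    rw [Formula.realize_inf, hr, Formula.realize_not] at hτ
    obtain ⟨⟨σ, hσ, hστ⟩, hB⟩ := hτ
    refine valid_iff.1 h σ τ hσ ?_
    clear hσ
    induction hστ using Relation.ReflTransGen.head_induction_on with
    | refl => exact .whileFalse hB
    | head h₁ _ ih => exact .whileTrue h₁.1 h₁.2 ih

/-- A valid correctness formula for a block follows in eight steps from suitable valid correctness
formulas for its body. -/
theorem exists_derivation_block [Infinite Var] (hexp : Expressive L Var M)
    {Φ : Set (CorrectnessFormula L Var ar)} {k : ℕ} {S : Stmt L Var ar}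
    (ih : ∀ p q, Valid M D p S q → ∃ d : Derivation M D .core Φ ⟨p, S, q⟩, d.size ≤ k)
    {m : ℕ} {x : Fin m ↪ Var} {t : Fin m → L.Term Var} {p q : Assertion L Var}
    (h : Valid M D p (.block x t S) q) :
    ∃ d : Derivation M D .core Φ ⟨p, .block x t S, q⟩, d.size ≤ k + 8 := by
  obtain ⟨y, hy⟩ := exists_fresh m (F := progVars D (.block x t S) ∪ p.free ∪ q.free)
    (((finite_progVars D _).union (finite_free p)).union (finite_free q))
  simp only [Set.disjoint_union_right] at hy
  obtain ⟨⟨hyv, hyp⟩, hyq⟩ := hy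
  have hyx : Disjoint (Set.range y) (Set.range x) :=
    hyv.mono_right fun a ha => .inr (.inl (.inl ha))
  have hyt : Disjoint (Set.range y) (termVars t) :=
    hyv.mono_right fun a ha => .inr (.inl (.inr ha))
  have xy : ∀ j, x j ∉ Set.range y := fun j hj => hyx.ne_of_mem hj ⟨j, rfl⟩ rfl
  have yx : ∀ j, y j ∉ Set.range x := fun j hj => hyx.ne_of_mem ⟨j, rfl⟩ hj rfl
  -- The fresh y saves the outer values of x. The block restores x and leaves y alone, so INVARIANCE
  -- applies to e; inside the block, q is stated about y instead of x.
  set e : Assertion L Var := eqVars x y with he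
  set q' := q.substitute x (fun j => Term.var (y j)) with hq'
  obtain ⟨r, hr⟩ := hexp n ar D (e ⊓ p) (.assign x t)
  have hbody : Valid M D r S q' := by
    refine valid_iff.2 fun ρ τ hρ hτ => ?_
    obtain ⟨σ, hσ, hσρ⟩ := (realize_iff_of_sp_eq hr ρ).1 hρ
    rw [Formula.realize_inf, he, realize_eqVars] at hσ
    rw [hq', realize_substitute]
    have hrun := Exec.block (hσρ.seq hτ)
    have : (fun j => σ (x j)) = fun j => (Term.var (y j) : L.Term Var).realize τ := by
      funext j
      rw [hσ.1 j, Term.realize_var]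
      have hyc : y j ∉ progChange D (.block x t S) := fun h =>
        hyv.ne_of_mem ⟨j, rfl⟩ (progChange_subset_progVars D _ h) rfl
      rw [← hrun.eq_of_notMem_progChange hyc, extend_apply_of_notMem (yx j)]
    rw [← this]
    exact valid_iff.1 h σ _ hσ.2 hrun
  obtain ⟨d, hd⟩ := ih r q' hbody
  have hassign : TrueIn M ((e ⊓ p).imp (r.substitute x t)) :=
    trueIn_imp.2 fun σ hσ => (realize_substitute _ _ _ _).2
      ((realize_iff_of_sp_eq hr _).2 ⟨σ, hσ, .assign x t σ⟩)
  have hq'x : Disjoint (Set.range x) q'.free := by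
    rw [Set.disjoint_right]
    intro a ha hax
    rcases mem_free_substitute_var ha with ha | ⟨j, rfl⟩
    · exact ha.2 hax
    · exact yx j hax
  have hec : Disjoint e.free (progChange D (.block x t S)) := by
    refine Disjoint.mono_left (free_eqVars_subset _ _) (Set.disjoint_union_left.2 ⟨?_, ?_⟩)
    · exact Set.disjoint_left.2 fun a ha hc => hc.2 ha
    · exact hyv.mono_right (progChange_subset_progVars D _)
  have pre : TrueIn M ((e ⊓ p).imp (e ⊓ (e ⊓ p))) := by
    refine trueIn_imp.2 fun σ hσ => ?_
    rw [Formula.realize_inf] at hσ ⊢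
    exact ⟨hσ.1, Formula.realize_inf.2 hσ⟩
  have post : TrueIn M ((e ⊓ q').imp q) := by
    refine trueIn_imp.2 fun τ hτ => ?_
    rw [Formula.realize_inf, he, realize_eqVars] at hτ
    have := (realize_substitute _ _ _ _).1 hτ.2
    simp only [Term.realize_var, ← hτ.1] at this
    rwa [extend_comp_self] at this
  have final : TrueIn M (p.imp ((e ⊓ p).existsVars y)) := by
    refine trueIn_imp.2 fun σ hσ => (realize_existsVars _ _ _).2 ⟨fun j => σ (x j), ?_⟩
    rw [Formula.realize_inf, he, realize_eqVars]
    refine ⟨fun j => ?_, (realize_extend_of_disjoint hyp _ _).2 hσ⟩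
    rw [extend_apply_of_notMem (xy j), y.injective.extend_apply]
  have id_true : ∀ φ : Assertion L Var, TrueIn M (φ.imp φ) := fun _ => trueIn_imp.2 fun _ => id
  -- Besides the proof `d` for the body: three consequences, one assignment axiom, and one each of
  -- composition, BLOCK, INVARIANCE and ∃-INTRODUCTION.
  refine ⟨.consequence final (id_true q) (.existsIntro y (Set.disjoint_union_right.2 ⟨hyv, hyq⟩)
    (.consequence pre post (.invariance e hec (.block hq'x
      (.composition (.consequence hassign (id_true r) (.assign x t r)) d))))), ?_⟩
  simp only [Derivation.size]
  omega

/-- Completeness, in a linear number of steps, of the system without the RECURSION rule relative to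
the most general correctness formulas for the generic calls. -/
theorem exists_derivation_core [Infinite Var] (hexp : Expressive L Var M) {N : ℕ}
    {x z : Fin N ↪ Var} (hp : ∀ i, Set.range (D.params i) ⊆ Set.range x)
    (hb : ∀ i, (D.body i).vars ⊆ Set.range x) (hz : Disjoint (Set.range z) (Set.range x))
    {G : Fin n → Assertion L Var} (hGu : ∀ i, Disjoint (Set.range (D.params i)) (G i).free)
    (hG : ∀ i, ∀ τ : Var → M, (G i).Realize τ → ∃ (d : Fin (ar i) → M) (σ : Var → M),
      (∀ j, σ (x j) = σ (z j)) ∧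
        Exec M D (D.genericCall i) σ (Function.extend (D.params i) d τ))
    {Φ : Set (CorrectnessFormula L Var ar)}
    (hΦ : ∀ i, ⟨eqVars x z, D.genericCall i, G i⟩ ∈ Φ) (S : Stmt L Var ar)
    (hS : S.vars ⊆ Set.range x) (p q : Assertion L Var) (h : Valid M D p S q) :
    ∃ d : Derivation M D .core Φ ⟨p, S, q⟩, d.size ≤ 6 * S.len := by
  have id_true : ∀ φ : Assertion L Var, TrueIn M (φ.imp φ) := fun _ => trueIn_imp.2 fun _ => id
  induction S generalizing p q with
  | skip =>
    refine ⟨.consequence (trueIn_imp.2 fun σ hσ => valid_iff.1 h σ σ hσ (.skip σ)) (id_true q)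
      (.skip q), by simp [Derivation.size, Stmt.len]⟩
  | assign y t =>
    refine ⟨.consequence (trueIn_imp.2 fun σ hσ => (realize_substitute _ _ _ _).2
      (valid_iff.1 h σ _ hσ (.assign y t σ))) (id_true q) (.assign y t q), ?_⟩
    simp [Derivation.size, Stmt.len]
  | call i t => exact exists_derivation_call hp hb hz (hGu i) (hG i) (hΦ i) hS h
  | seq S₁ S₂ ih₁ ih₂ =>
    obtain ⟨r, hr⟩ := hexp n ar D p S₁
    obtain ⟨d₁, hd₁⟩ := ih₁ (Set.subset_union_left.trans hS) p r hr.subset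
    obtain ⟨d₂, hd₂⟩ := ih₂ (Set.subset_union_right.trans hS) r q
      (valid_iff.2 fun ρ τ hρ e₂ => by
        obtain ⟨σ, hσ, e₁⟩ := (realize_iff_of_sp_eq hr ρ).1 hρ
        exact valid_iff.1 h σ τ hσ (e₁.seq e₂))
    refine ⟨.composition d₁ d₂, ?_⟩
    simp only [Derivation.size, Stmt.len]
    omega
  | ite B S₁ S₂ ih₁ ih₂ =>
    obtain ⟨d₁, hd₁⟩ := ih₁ ((Set.subset_union_right.trans Set.subset_union_left).trans hS)
      (p ⊓ B.1) q (valid_iff.2 fun σ τ hσ e =>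
        valid_iff.1 h σ τ (Formula.realize_inf.1 hσ).1 (.iteTrue (Formula.realize_inf.1 hσ).2 e))
    obtain ⟨d₂, hd₂⟩ := ih₂ (Set.subset_union_right.trans hS) (p ⊓ B.1.not) q
      (valid_iff.2 fun σ τ hσ e => valid_iff.1 h σ τ (Formula.realize_inf.1 hσ).1
        (.iteFalse (Formula.realize_not.1 (Formula.realize_inf.1 hσ).2) e))
    refine ⟨.conditional d₁ d₂, ?_⟩
    simp only [Derivation.size, Stmt.len]
    omega
  | block y t S ih =>
    obtain ⟨d, hd⟩ := exists_derivation_block hexp (ih (Set.subset_union_right.trans hS)) h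
    refine ⟨d, hd.trans ?_⟩
    simp only [Stmt.len]
    omega
  -- The remaining case is the loop.
  | _ =>
    rename_i B S ih
    obtain ⟨r, hpr, hr, hrq⟩ := exists_while_invariant hexp h
    obtain ⟨d, hd⟩ := ih (Set.subset_union_right.trans hS) _ _ hr
    refine ⟨.consequence hpr hrq (.while d), ?_⟩
    simp only [Derivation.size, Stmt.len]
    omega

theorem provableIn_of_valid [Infinite Var] (hexp : Expressive L Var M) {T : Stmt L Var ar}
    {p q : Assertion L Var} (h : Valid M D p T q) (Φ : Set (CorrectnessFormula L Var ar)) :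
    ProvableIn M D Φ (7 * progLen D T) ⟨p, T, q⟩ := by
  obtain ⟨N, x, hx⟩ := exists_range_eq_progVars D T
  obtain ⟨z, hz⟩ := exists_fresh N (Set.finite_range x)
  have hp : ∀ i, Set.range (D.params i) ⊆ Set.range x := hx ▸ params_subset_progVars D T
  have hb : ∀ i, (D.body i).vars ⊆ Set.range x := hx ▸ body_vars_subset_progVars D T
  choose φ hφ using fun i => hexp n ar D (eqVars x z) (D.genericCall i)
  let G : Fin n → Assertion L Var := fun i => (φ i).existsVars (D.params i)
  have hG : ∀ i, ∀ τ : Var → M, (G i).Realize τ ↔ ∃ (d : Fin (ar i) → M) (σ : Var → M),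
      (∀ j, σ (x j) = σ (z j)) ∧
        Exec M D (D.genericCall i) σ (Function.extend (D.params i) d τ) := by
    intro i τ
    simp only [G, realize_existsVars, realize_iff_of_sp_eq (hφ i), realize_eqVars]
  have hGu : ∀ i, Disjoint (Set.range (D.params i)) (G i).free := fun i =>
    disjoint_free_existsVars _ _
  have core := exists_derivation_core hexp hp hb hz hGu (fun i τ => (hG i τ).1)
    (Φ := Set.range fun i => ⟨eqVars x z, D.genericCall i, G i⟩) fun i => ⟨i, rfl⟩
  obtain ⟨d, hd⟩ := core T (hx ▸ Set.subset_union_right) p q h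
  -- Resetting u_i turns a run of the body into one of the generic call, so the initial values of
  -- u_i witness the quantifier in G_i.
  choose e he using fun i => core (D.body i) (hb i) (eqVars x z) (G i)
    (valid_iff.2 fun σ τ hσ hτ => (hG i τ).2 ⟨_, σ, (realize_eqVars _ _ _).1 hσ,
      exec_genericCall_iff.2 ⟨τ, hτ, rfl⟩⟩)
  refine ⟨.recursion (fun _ => eqVars x z) G hGu d e, ?_⟩
  have hsum : ∑ i, (e i).size ≤ 6 * ∑ i, (D.body i).len := by
    rw [Finset.mul_sum]
    exact Finset.sum_le_sum fun i _ => he i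
  -- Absorbs the single application of RECURSION, raising 6 to 7.
  have := T.one_le_len
  simp only [Derivation.size, progLen]
  omega

end Completeness

end CBV

theorem mainTheorem2 :
    ∃ C : ℕ, ∀ (L : FirstOrder.Language.{u, v}) (Var : Type w) [DecidableEq Var] [Infinite Var]
      (M : Type z) [L.Structure M] [Nonempty M],
      CBV.Expressive L Var M →
      ∀ (n : ℕ) (ar : Fin n → ℕ) (D : CBV.Decls L Var ar) (T : CBV.Stmt L Var ar)
        (p q : CBV.Assertion L Var),
        CBV.Valid M D p T q →
        CBV.ProvableIn M D ∅ (C * CBV.progLen D T) ⟨p, T, q⟩ := by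
  exact ⟨7, fun _ _ _ _ _ _ _ hexp _ _ _ _ _ _ h => CBV.provableIn_of_valid hexp h ∅⟩
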